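/- Let $J[\mathbf u]=\mathbb R[u_{(0)},u_{(1)},u_{(2)},\dots]$ be the algebra of polynomial differential functions, with total derivative $D\mathfrak p=\sum_k \frac{\partial \mathfrak p}{\partial u_{(k)}}u_{(k+1)}$ and Euler operator $\mathcal E(\mathfrak p)=\sum_\ell(-1)^\ell D^\ell\big(\frac{\partial\mathfrak p}{\partial u_{(\ell)}}\big)$. If $\mathfrak p$ is a total derivative, $D^{-1}\mathfrak p$ denotes the unique $\mathfrak r\in J[\mathbf u]$ with $D\mathfrak r=\mathfrak p$ and zero constant term. Let $P[\mathbf u]=\{\mathfrak p:\mathcal E(u_{(0)}D^3\mathfrak p+4u_{(0)}^2D\mathfrak p)=0\}$ and $P'[\mathbf u]=D(P[\mathbf u])$. Define the operators $$\mathcal D(\mathfrak w)=D^3\mathfrak w+2u_{(0)}D\mathfrak w+u_{(1)}\mathfrak w,$$ $$\mathcal J(\mathfrak q)=D^3\mathfrak q+8u_{(0)}D\mathfrak q+7u_{(1)}\mathfrak q+2\big(u_{(2)}+4u_{(0)}^2\big)D^{-1}\mathfrak q+2D^{-1}\big(u_{(0)}D^2\mathfrak q+4u_{(0)}^2\mathfrak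 q\big)\qquad(\mathfrak q\in P'[\mathbf u]),$$ and, for $\mathfrak p\in P[\mathbf u]$, $$\begin{aligned}\mathcal S(\mathfrak p)={}&\tfrac19u_{(1)}D^{-1}\big(u_{(0)}D^3\mathfrak p+4u_{(0)}^2D\mathfrak p\big)+\tfrac19\big(20u_{(0)}^2u_{(1)}+25u_{(1)}u_{(2)}+10u_{(0)}u_{(3)}+u_{(5)}\big)\mathfrak p\\&+\big(\tfrac32+\tfrac{16}9u_{(0)}^3+\tfrac{71}{18}u_{(1)}^2+\tfrac{41}9u_{(0)}u_{(2)}+\tfrac{13}{18}u_{(4)}\big)D\mathfrak p+\big(\tfrac{59}9u_{(0)}u_{(1)}+\tfrac{35}{18}u_{(3)}\big)D^2\mathfrak p\\&+\big(2u_{(0)}^2+\tfrac{49}{18}u_{(2)}\big)D^3\mathfrak p+2u_{(1)}D^4\mathfrak p+\tfrac23u_{(0)}D^5\mathfrak p+\tfrac1{18}D^7\mathfrak p.\end{aligned}$$ Let $\mathfrak h_0=1$, $\mathfrak h_1=u_{(2)}+4u_{(0)}^2$, $\mathfrak h_{n+2}=\mathcal J\mathcal D(\mathfrak h_n)$ and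 $\mathfrak q_n=D^{-1}\mathcal D(\mathfrak h_n)$. The $n$-th equation of the Kaup--Kupershmidt hierarchy for a smooth function $u(s,t)$ is $$\mathcal K_n:\quad u_t+\mathcal D(\mathfrak h_n)|_{j_s(u)}=0,$$ where $|_{j_s(u)}$ means the substitution $u_{(k)}=\partial_s^ku$. Put $\mathfrak w_0=0$, $\mathfrak w_1=\frac12$, $\mathfrak w_n=\mathfrak q_{n-2}$ for $n>1$, and for $n\ge1$ $$\ell_n=\Big[\frac n2\Big]-\frac{1+(-1)^n}2,\qquad \lambda_n=\frac{1+(-1)^n}2(-27)^{[n/2]},\qquad \mathfrak v_n=18\sum_{h=0}^{\ell_n}(-27)^h\mathfrak w_{n-2h}.$$ Then all these objects are well defined: for every $k\ge0$, $\mathcal D(\mathfrak h_k)$ is a total derivative, so that $D\mathfrak q_k=\mathcal D(\mathfrak h_k)$, and $\mathfrak q_k\in P[\mathbf u]$. For every $n\ge1$ one has $\mathfrak v_n\in P[\mathbf u]$ and $$\mathcal D(\mathfrak h_n)=\mathcal S(\mathfrak v_n)+\lambda_nu_{(1)}.$$ Consequently, for every smooth $u$ on an open subset of the $(s,t)$-plane,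 the equation $\mathcal K_n$ can be written in the equivalent form $$u_t+\mathcal S(\mathfrak v_n)|_{j_s(u)}+\lambda_nu_s=0.$$ -/

import Mathlib

open scoped ContDiff

noncomputable section

namespace KaupKupershmidt

/-- The algebra of polynomial differential functions: real polynomials in the jet
coordinates `u₍₀₎, u₍₁₎, u₍₂₎, …`. -/
abbrev DiffPoly : Type := MvPolynomial ℕ ℝ

/-- The jet coordinate `u₍ₖ₎`. -/
def U (k : ℕ) : DiffPoly := MvPolynomial.X k

/-- The total derivative `D p = ∑ₖ (∂p/∂u₍ₖ₎) u₍ₖ₊₁₎`, i.e. the derivation of the algebra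
with `D u₍ₖ₎ = u₍ₖ₊₁₎`. -/
def totalDeriv : Derivation ℝ DiffPoly DiffPoly :=
  MvPolynomial.mkDerivation ℝ (fun k => U (k + 1))

/-- The iterated total derivative `D^k p`. -/
def totalDerivPow (k : ℕ) (p : DiffPoly) : DiffPoly := totalDeriv^[k] p

/-- The Euler operator `E(p) = ∑ₗ (-1)^ℓ D^ℓ (∂p/∂u₍ₗ₎)`; only the finitely many variables
that occur in `p` contribute. -/
def euler (p : DiffPoly) : DiffPoly :=
  ∑ l ∈ p.vars, (-1) ^ l * totalDerivPow l (MvPolynomial.pderiv l p)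

open Classical in
/-- `D⁻¹ p`: the (unique) differential polynomial `r` with `D r = p` and `r|₀ = 0`
(evaluation at the zero jet is the constant coefficient), when there is one; the value is `0`
if `p` is not a total derivative. -/
def invD (p : DiffPoly) : DiffPoly :=
  if h : ∃ r : DiffPoly, totalDeriv r = p ∧ MvPolynomial.constantCoeff r = 0
  then Classical.choose h else 0

/-- The space `P[u]` of all `p` with `E(u₍₀₎ D³p + 4 u₍₀₎² D p) = 0`. -/
def PSpace : Set DiffPoly :=
  {p | euler (U 0 * totalDerivPow 3 p + 4 * U 0 ^ 2 * totalDeriv p) = 0}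

/-- The operator `𝒟(w) = D³w + 2 u₍₀₎ D w + u₍₁₎ w`. -/
def opD (w : DiffPoly) : DiffPoly :=
  totalDerivPow 3 w + 2 * U 0 * totalDeriv w + U 1 * w

/-- The operator `𝒥`, meaningful on the image of `P[u]` under `D`. -/
def opJ (q : DiffPoly) : DiffPoly :=
  totalDerivPow 3 q + 8 * U 0 * totalDeriv q + 7 * U 1 * q
    + 2 * (U 2 + 4 * U 0 ^ 2) * invD q
    + 2 * invD (U 0 * totalDerivPow 2 q + 4 * U 0 ^ 2 * q)

/-- The seventh-order integro-differential operator `𝒮`, meaningful on `P[u]`. -/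
def opS (p : DiffPoly) : DiffPoly :=
  (1 / 9 : ℝ) • (U 1 * invD (U 0 * totalDerivPow 3 p + 4 * U 0 ^ 2 * totalDeriv p))
    + (1 / 9 : ℝ) • ((20 * U 0 ^ 2 * U 1 + 25 * U 1 * U 2 + 10 * U 0 * U 3 + U 5) * p)
    + (MvPolynomial.C (3 / 2 : ℝ) + (16 / 9 : ℝ) • U 0 ^ 3 + (71 / 18 : ℝ) • U 1 ^ 2
        + (41 / 9 : ℝ) • (U 0 * U 2) + (13 / 18 : ℝ) • U 4) * totalDeriv p
    + ((59 / 9 : ℝ) • (U 0 * U 1) + (35 / 18 : ℝ) • U 3) * totalDerivPow 2 p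
    + (2 * U 0 ^ 2 + (49 / 18 : ℝ) • U 2) * totalDerivPow 3 p
    + 2 * U 1 * totalDerivPow 4 p
    + (2 / 3 : ℝ) • (U 0 * totalDerivPow 5 p)
    + (1 / 18 : ℝ) • totalDerivPow 7 p

/-- The polynomials `h₀ = 1`, `h₁ = u₍₂₎ + 4 u₍₀₎²`, `hₙ₊₂ = 𝒥 𝒟 hₙ`. -/
def hPoly : ℕ → DiffPoly
  | 0 => 1
  | 1 => U 2 + 4 * U 0 ^ 2
  | n + 2 => opJ (opD (hPoly n))

/-- The conserved fluxes `qₙ = D⁻¹ 𝒟 hₙ`. -/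
def qPoly (n : ℕ) : DiffPoly := invD (opD (hPoly n))

/-- `w₀ = 0`, `w₁ = 1/2`, `wₙ = qₙ₋₂` for `n > 1`. -/
def wPoly : ℕ → DiffPoly
  | 0 => 0
  | 1 => MvPolynomial.C (1 / 2 : ℝ)
  | n + 2 => qPoly n

/-- `ℓₙ = [n/2] - (1 + (-1)ⁿ)/2`, for `n ≥ 1`. -/
def ell (n : ℕ) : ℕ := n / 2 - (if Even n then 1 else 0)

/-- `λₙ = (1 + (-1)ⁿ)/2 · (-27)^[n/2]`. -/
def lam (n : ℕ) : ℝ := if Even n then (-27) ^ (n / 2) else 0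

/-- `vₙ = 18 ∑_{h=0}^{ℓₙ} (-27)^h wₙ₋₂ₕ`, for `n ≥ 1`. -/
def vPoly (n : ℕ) : DiffPoly :=
  18 * ∑ h ∈ Finset.range (ell n + 1), (-27) ^ h * wPoly (n - 2 * h)

/-- The partial `s`-derivative of order `k` of `u(s,t)`, at the point `z = (s,t)`. -/
def partialS (k : ℕ) (u : ℝ × ℝ → ℝ) (z : ℝ × ℝ) : ℝ :=
  iteratedDeriv k (fun s => u (s, z.2)) z.1

/-- The partial `t`-derivative of `u(s,t)`, at the point `z = (s,t)`. -/
def partialT (u : ℝ × ℝ → ℝ) (z : ℝ × ℝ) : ℝ :=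
  deriv (fun t => u (z.1, t)) z.2

/-- The value `p|_{j_s(u)}` of `p` along the partial prolongation of `u`, at `z = (s,t)`. -/
def alongJet (p : DiffPoly) (u : ℝ × ℝ → ℝ) (z : ℝ × ℝ) : ℝ :=
  MvPolynomial.eval (fun k => partialS k u z) p

/-- `u` solves on `Ω` the `n`-th equation of the hierarchy, `u_t + 𝒟 hₙ |_{j_s(u)} = 0`. -/
def SolvesKK (n : ℕ) (Ω : Set (ℝ × ℝ)) (u : ℝ × ℝ → ℝ) : Prop :=
  ∀ z ∈ Ω, partialT u z + alongJet (opD (hPoly n)) u z = 0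

end KaupKupershmidt

end

/-!
The operator `L = 𝒟 = D³ + 2u₍₀₎D + u₍₁₎` is skew-adjoint, and the hierarchy is governed by the
spectral problem `Lφ = λφ`. If also `Lψ = -λψ`, then `ρ = φψ` and `α = φ'ψ - φψ'` satisfy
`𝒟α = 3λDρ` and `D𝒥Dρ = -9λDα` (`waveProduct_identities`), so that `α` and `ρ`, expanded in powers
of `z⁻¹` where `λ = z³`, are generating functions of the `hₙ` and of the `qₙ`, up to constant
factors.

All the locality claims follow once `ρ` and `α` are known to have differential polynomials as
coefficients. The logarithmic derivatives `v` of `φ` and `w` of `ψ` do, because their Riccati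
equations can be solved coefficient by coefficient (`exists_riccati_solution`). The bilinear
concomitant `φψ'' - φ'ψ' + φ''ψ + 2u₍₀₎φψ` is constant; it equals `φψ` times the differential
polynomial `v' + w' + v² - vw + w² + 2u₍₀₎` in `v` and `w`, hence `ρ` may be taken to be the inverse
of the latter, a power series with invertible leading coefficient, and `α = (v - w)ρ`
(`resolvent_identities`). Since the kernel of `D` consists of the constants, and the coefficients of
positive order vanish at the zero jet, this local solution agrees with the recursion by `D⁻¹`
(`exists_flux`). In particular `u₍₀₎D³qₙ + 4u₍₀₎²Dqₙ` is a total derivative, hence is annihilated by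
the Euler operator (`euler_totalDeriv`), that is, `qₙ ∈ P[u]`.

Direct expansion gives `𝒟𝒥D = 18𝒮 - 27D` (`opD_eq_opSAux`), hence
`𝒟hₙ₊₂ = 18𝒮(qₙ) - 27𝒟hₙ`; since `vₙ₊₂ = 18qₙ - 27vₙ` and `λₙ₊₂ = -27λₙ`, the identity
`𝒟hₙ = 𝒮(vₙ) + λₙu₍₁₎` follows by induction from `n = 0` and `n = 1` (`exists_factorisation`).
-/

namespace KaupKupershmidt

/-! ### Total derivatives, their kernel and the Euler operator -/

@[simp] lemma totalDeriv_U (k : ℕ) : totalDeriv (U k) = U (k + 1) := by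
  simp [totalDeriv, U]

@[simp] lemma constantCoeff_U (k : ℕ) : MvPolynomial.constantCoeff (U k) = 0 := by
  simp [U]

lemma totalDeriv_smul (c : ℝ) (p : DiffPoly) : totalDeriv (c • p) = c • totalDeriv p :=
  Derivation.map_smul _ _ _

lemma totalDeriv_C (c : ℝ) : totalDeriv (MvPolynomial.C c) = 0 :=
  MvPolynomial.derivation_C _ _

lemma derivation_ofNat {A : Type*} [CommRing A] [Algebra ℝ A] (δ : Derivation ℝ A A) (n : ℕ)
    [n.AtLeastTwo] : δ (OfNat.ofNat n) = 0 := by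
  rw [← Nat.cast_ofNat, Derivation.map_natCast]

lemma totalDerivPow_succ (k : ℕ) (p : DiffPoly) :
    totalDerivPow (k + 1) p = totalDeriv (totalDerivPow k p) :=
  Function.iterate_succ_apply' _ _ _

lemma totalDerivPow_succ' (k : ℕ) (p : DiffPoly) :
    totalDerivPow (k + 1) p = totalDerivPow k (totalDeriv p) :=
  Function.iterate_succ_apply _ _ _

@[simp] lemma totalDerivPow_zero (p : DiffPoly) : totalDerivPow 0 p = p := rfl

lemma totalDerivPow_add (k : ℕ) (p q : DiffPoly) :
    totalDerivPow k (p + q) = totalDerivPow k p + totalDerivPow k q := by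
  induction k with
  | zero => rfl
  | succ k ih => simp only [totalDerivPow_succ, ih, map_add]

@[simp] lemma totalDerivPow_map_zero (k : ℕ) : totalDerivPow k 0 = 0 := by
  induction k with
  | zero => rfl
  | succ k ih => simp only [totalDerivPow_succ, ih, map_zero]

@[simp] lemma constantCoeff_totalDeriv (p : DiffPoly) :
    MvPolynomial.constantCoeff (totalDeriv p) = 0 := by
  induction p using MvPolynomial.induction_on with
  | C a => simp [totalDeriv]
  | add p q hp hq => simp [hp, hq]
  | mul_X p n hp =>
    have : totalDeriv (MvPolynomial.X n) = U (n + 1) := totalDeriv_U n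
    simp [Derivation.leibniz, hp, this]

/-- Commutation of `∂/∂u₍₀₎` with the total derivative. -/
lemma pderiv_zero_totalDeriv (p : DiffPoly) :
    MvPolynomial.pderiv 0 (totalDeriv p) = totalDeriv (MvPolynomial.pderiv 0 p) := by
  have h : ⁅(MvPolynomial.pderiv 0 : Derivation ℝ DiffPoly DiffPoly), totalDeriv⁆ = 0 := by
    apply MvPolynomial.derivation_ext
    intro i
    have hi : totalDeriv (MvPolynomial.X i) = MvPolynomial.X (i + 1) := totalDeriv_U i
    rw [Derivation.commutator_apply, hi, MvPolynomial.pderiv_X, MvPolynomial.pderiv_X]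
    rcases i with _ | i <;> simp
  have := DFunLike.congr_fun h p
  rwa [Derivation.commutator_apply, Derivation.zero_apply, sub_eq_zero] at this

/-- Commutation of `∂/∂u₍ₗ₊₁₎` with the total derivative. -/
lemma pderiv_succ_totalDeriv (l : ℕ) (p : DiffPoly) :
    MvPolynomial.pderiv (l + 1) (totalDeriv p)
      = totalDeriv (MvPolynomial.pderiv (l + 1) p) + MvPolynomial.pderiv l p := by
  have h : ⁅(MvPolynomial.pderiv (l + 1) : Derivation ℝ DiffPoly DiffPoly), totalDeriv⁆
      = MvPolynomial.pderiv l := by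
    apply MvPolynomial.derivation_ext
    intro i
    have hi : totalDeriv (MvPolynomial.X i) = MvPolynomial.X (i + 1) := totalDeriv_U i
    rw [Derivation.commutator_apply, hi, MvPolynomial.pderiv_X, MvPolynomial.pderiv_X,
      MvPolynomial.pderiv_X]
    by_cases hil : i = l
    · subst hil; simp
    · have h1 : i + 1 ≠ l + 1 := by omega
      by_cases hil' : i = l + 1 <;> simp [hil, hil']
  have := DFunLike.congr_fun h p
  rw [Derivation.commutator_apply] at this
  rw [← this]; ring

lemma exists_forall_ge_pderiv_eq_zero (p : DiffPoly) :
    ∃ N : ℕ, p.vars ⊆ Finset.range N ∧ ∀ l, N ≤ l → MvPolynomial.pderiv l p = 0 := by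
  obtain ⟨N, hN⟩ := p.vars.exists_nat_subset_range
  refine ⟨N, hN, fun l hl => MvPolynomial.pderiv_eq_zero_of_notMem_vars fun h => ?_⟩
  have := Finset.mem_range.mp (hN h)
  omega

lemma euler_eq_sum_range {p : DiffPoly} {N : ℕ} (h : p.vars ⊆ Finset.range N) :
    euler p = ∑ l ∈ Finset.range N, (-1) ^ l * totalDerivPow l (MvPolynomial.pderiv l p) := by
  refine Finset.sum_subset h fun l _ hl => ?_
  rw [MvPolynomial.pderiv_eq_zero_of_notMem_vars hl]
  simp

/-- The Euler operator annihilates total derivatives: the defining sum telescopes. -/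
theorem euler_totalDeriv (p : DiffPoly) : euler (totalDeriv p) = 0 := by
  obtain ⟨M, -, hM⟩ := exists_forall_ge_pderiv_eq_zero p
  obtain ⟨N, hN, -⟩ := exists_forall_ge_pderiv_eq_zero (totalDeriv p)
  have key : ∀ K : ℕ, ∑ l ∈ Finset.range (K + 1),
      (-1) ^ l * totalDerivPow l (MvPolynomial.pderiv l (totalDeriv p))
        = (-1) ^ K * totalDerivPow (K + 1) (MvPolynomial.pderiv K p) := by
    intro K
    induction K with
    | zero => simp [pderiv_zero_totalDeriv, totalDerivPow_succ]
    | succ K ih =>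
      rw [Finset.sum_range_succ, ih, pderiv_succ_totalDeriv, totalDerivPow_add,
        ← totalDerivPow_succ']
      ring
  have hsub : (totalDeriv p).vars ⊆ Finset.range (max M N + 1) :=
    hN.trans (Finset.range_subset_range.mpr (by omega))
  rw [euler_eq_sum_range hsub, key, hM _ (le_max_left _ _)]
  simp

/-- The kernel of the total derivative consists of the constants. -/
theorem eq_C_of_totalDeriv_eq_zero {p : DiffPoly} (h : totalDeriv p = 0) :
    p = MvPolynomial.C (MvPolynomial.constantCoeff p) := by
  obtain ⟨N, -, hN⟩ := exists_forall_ge_pderiv_eq_zero p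
  -- `∂p/∂u₍ₗ₎ = -D(∂p/∂u₍ₗ₊₁₎)`, so all partial derivatives vanish by downward induction.
  have key : ∀ k l, N ≤ l + k → MvPolynomial.pderiv l p = 0 := by
    intro k
    induction k with
    | zero => exact fun l hl => hN l hl
    | succ k ih =>
      intro l hl
      have := pderiv_succ_totalDeriv l p
      rw [h, ih (l + 1) (by omega)] at this
      simpa using this.symm
  ext m
  rw [MvPolynomial.coeff_C]
  split_ifs with hm
  · subst hm; rfl
  · obtain ⟨i, hi⟩ : ∃ i, m i ≠ 0 := by
      by_contra! hc
      exact hm (Finsupp.ext fun i => (hc i).symm)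
    have h0 := congrArg (MvPolynomial.coeff (m - Finsupp.single i 1)) (key N i (by omega))
    have hle : Finsupp.single i 1 ≤ m := by
      rw [Finsupp.single_le_iff]; omega
    rw [MvPolynomial.coeff_pderiv, tsub_add_cancel_of_le hle, MvPolynomial.coeff_zero] at h0
    rcases mul_eq_zero.mp h0 with h1 | h1
    · exact h1
    · exact absurd h1 (by positivity)

lemma eq_of_totalDeriv_eq {p q : DiffPoly} (h : totalDeriv p = totalDeriv q)
    (h0 : MvPolynomial.constantCoeff p = MvPolynomial.constantCoeff q) : p = q := by
  have := eq_C_of_totalDeriv_eq_zero (p := p - q) (by rw [map_sub, h, sub_self])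
  rwa [map_sub, h0, sub_self, map_zero, sub_eq_zero] at this

theorem invD_eq {p r : DiffPoly} (h : totalDeriv r = p)
    (h0 : MvPolynomial.constantCoeff r = 0) : invD p = r := by
  have hex : ∃ r : DiffPoly, totalDeriv r = p ∧ MvPolynomial.constantCoeff r = 0 := ⟨r, h, h0⟩
  have hs := Classical.choose_spec hex
  rw [invD, dif_pos hex]
  exact eq_of_totalDeriv_eq (hs.1.trans h.symm) (hs.2.trans h0.symm)

section Series

open PowerSeries

/-! ### Products of wave functions in a differential algebra -/

section WaveProducts

variable {A : Type*} [CommRing A] [Algebra ℝ A] (δ : Derivation ℝ A A)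

/-- Let `E i j` satisfy the differentiation rules of the products `φ⁽ⁱ⁾ψ⁽ʲ⁾`, where
`φ''' + 2Wφ' + W'φ = φ` and `ψ''' + 2Wψ' + W'ψ = -ψ`. Then the two combinations `ρ = φψ` and
`α = φ'ψ - φψ'` satisfy two coupled linear equations. -/
theorem waveProduct_identities {W E00 E10 E01 E20 E02 E11 E21 E12 E22 : A}
    (h00 : δ E00 = E10 + E01)
    (h10 : δ E10 = E20 + E11)
    (h01 : δ E01 = E11 + E02)
    (h20 : δ E20 = E00 - 2 * W * E10 - δ W * E00 + E21)
    (h02 : δ E02 = E12 + (-E00 - 2 * W * E01 - δ W * E00))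
    (h11 : δ E11 = E21 + E12)
    (h21 : δ E21 = E01 - 2 * W * E11 - δ W * E01 + E22)
    (h12 : δ E12 = E22 + (-E10 - 2 * W * E11 - δ W * E10))
    (h22 : δ E22 = E02 - 2 * W * E12 - δ W * E02 + (-E20 - 2 * W * E21 - δ W * E20)) :
    δ (δ (δ (E10 - E01))) + 2 * W * δ (E10 - E01) + δ W * (E10 - E01) = 3 * δ E00 ∧
      δ (δ (δ (δ (δ E00)))) + 10 * W * δ (δ (δ E00)) + 15 * δ W * δ (δ E00)
        + (9 * δ (δ W) + 16 * W ^ 2) * δ E00 + (2 * δ (δ (δ W)) + 16 * W * δ W) * E00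
        = -9 * δ (E10 - E01) := by
  have h2 : δ 2 = 0 := derivation_ofNat δ 2
  constructor
  · simp only [map_add, map_sub, map_neg, Derivation.leibniz, smul_eq_mul, h2,
      h00, h10, h01, h20, h02, h11, h21, h12]
    ring
  · simp only [map_add, map_sub, map_neg, map_zero, Derivation.leibniz, smul_eq_mul, h2,
      h00, h10, h01, h20, h02, h11, h21, h12, h22]
    ring

/-- Given logarithmic derivatives `v`, `w` of wave functions `φ`, `ψ` of opposite spectral
parameter, the bilinear concomitant `φψ'' - φ'ψ' + φ''ψ + 2Wφψ` is constant, so that `φψ` is,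
up to a constant factor, the inverse `ρ` of its quotient by `φψ`: the product of the wave
functions is local although neither factor is. -/
theorem resolvent_identities {W v w ρ : A}
    (hv : δ (δ v) + 3 * v * δ v + v ^ 3 + 2 * W * v + δ W = 1)
    (hw : δ (δ w) + 3 * w * δ w + w ^ 3 + 2 * W * w + δ W = -1)
    (hρ : (δ v + δ w + v ^ 2 - v * w + w ^ 2 + 2 * W) * ρ = 1) :
    δ (δ (δ ((v - w) * ρ))) + 2 * W * δ ((v - w) * ρ) + δ W * ((v - w) * ρ) = 3 * δ ρ ∧
      δ (δ (δ (δ (δ ρ)))) + 10 * W * δ (δ (δ ρ)) + 15 * δ W * δ (δ ρ)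
        + (9 * δ (δ W) + 16 * W ^ 2) * δ ρ + (2 * δ (δ (δ W)) + 16 * W * δ W) * ρ
        = -9 * δ ((v - w) * ρ) := by
  have hδρ : δ ρ = (v + w) * ρ := by
    have h2 : δ 2 = 0 := derivation_ofNat δ 2
    have h := congrArg δ hρ
    simp only [map_add, map_sub, Derivation.leibniz, smul_eq_mul, pow_two, h2,
      Derivation.map_one_eq_zero] at h
    linear_combination ρ * h - ρ ^ 2 * (hv + hw) + ((v + w) * ρ - δ ρ) * hρ
  have hv' : δ (δ v) = 1 - 3 * v * δ v - v ^ 3 - 2 * W * v - δ W := by linear_combination hv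
  have hw' : δ (δ w) = -1 - 3 * w * δ w - w ^ 3 - 2 * W * w - δ W := by linear_combination hw
  rw [sub_mul]
  -- `φ⁽ⁱ⁾ψ⁽ʲ⁾` is `ρ` times a differential polynomial in `v` and one in `w`.
  refine waveProduct_identities δ (E20 := (δ v + v ^ 2) * ρ) (E02 := (δ w + w ^ 2) * ρ)
    (E11 := v * w * ρ) (E21 := (δ v + v ^ 2) * w * ρ) (E12 := v * (δ w + w ^ 2) * ρ)
    (E22 := (δ v + v ^ 2) * (δ w + w ^ 2) * ρ) ?_ ?_ ?_ ?_ ?_ ?_ ?_ ?_ ?_ <;>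
  · simp only [map_add, Derivation.leibniz, smul_eq_mul, pow_two, hδρ, hv', hw']
    ring

end WaveProducts

/-! ### Formal power series of differential polynomials -/

/-- The total derivative, acting coefficientwise on formal power series. -/
noncomputable def seriesDeriv : Derivation ℝ DiffPoly⟦X⟧ DiffPoly⟦X⟧ where
  toFun f := PowerSeries.mk fun n => totalDeriv (coeff n f)
  map_add' f g := by ext1 n; simp
  map_smul' c f := by ext1 n; simp
  map_one_eq_zero' := by
    ext1 n
    simp only [LinearMap.coe_mk, AddHom.coe_mk, coeff_mk, coeff_one]
    split_ifs <;> simp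
  leibniz' f g := by
    ext1 n
    simp only [LinearMap.coe_mk, AddHom.coe_mk, coeff_mk, coeff_mul, map_add, map_sum,
      Derivation.leibniz, smul_eq_mul, Finset.sum_add_distrib]
    congr 1
    rw [← Finset.Nat.sum_antidiagonal_swap]
    rfl

@[simp] lemma coeff_seriesDeriv (n : ℕ) (f : DiffPoly⟦X⟧) :
    coeff n (seriesDeriv f) = totalDeriv (coeff n f) :=
  coeff_mk n fun n => totalDeriv (coeff n f)

@[simp] lemma seriesDeriv_X_pow (n : ℕ) : seriesDeriv (X ^ n) = 0 := by
  ext1 m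
  rw [coeff_seriesDeriv, coeff_X_pow]
  split_ifs <;> simp

@[simp] lemma seriesDeriv_C (p : DiffPoly) : seriesDeriv (C p) = C (totalDeriv p) := by
  ext1 m
  rw [coeff_seriesDeriv, coeff_C, coeff_C]
  split_ifs <;> simp

/-- The derivation `z⁻¹ D`, where the formal variable `X` stands for the inverse `z⁻¹` of the
cube root of the spectral parameter. In this scaling, the spectral parameter becomes `±1`. -/
noncomputable def scaledDeriv : Derivation ℝ DiffPoly⟦X⟧ DiffPoly⟦X⟧ :=
  (X : DiffPoly⟦X⟧) • seriesDeriv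

lemma scaledDeriv_apply (f : DiffPoly⟦X⟧) : scaledDeriv f = X * seriesDeriv f := rfl

@[simp] lemma seriesDeriv_X : seriesDeriv X = 0 := by
  simpa using seriesDeriv_X_pow 1

lemma scaledDeriv_X_pow_mul (n : ℕ) (f : DiffPoly⟦X⟧) :
    scaledDeriv (X ^ n * f) = X ^ (n + 1) * seriesDeriv f := by
  rw [scaledDeriv_apply, Derivation.leibniz, seriesDeriv_X_pow]
  simp only [smul_eq_mul, mul_zero, add_zero]
  ring

/-- The potential `u₍₀₎`, in the scaling of `scaledDeriv`. -/
noncomputable def potential : DiffPoly⟦X⟧ := X ^ 2 * C (U 0)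

/-- A map of power series that increases the order of contact has a fixed point. -/
theorem exists_fixedPoint_of_contracting {R : Type*} [CommRing R] (S : Set R⟦X⟧)
    (T : R⟦X⟧ → R⟦X⟧) (x₀ : R⟦X⟧) (h₀ : x₀ ∈ S) (hS : ∀ f g, f ∈ S → X ∣ g - f → g ∈ S)
    (hT : ∀ f ∈ S, T f ∈ S)
    (hc : ∀ f ∈ S, ∀ g ∈ S, ∀ n, X ^ n ∣ f - g → X ^ (n + 1) ∣ T f - T g) :
    ∃ f ∈ S, T f = f := by
  set x : ℕ → R⟦X⟧ := fun n => T^[n] x₀ with hx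
  have hsucc (n : ℕ) : x (n + 1) = T (x n) := Function.iterate_succ_apply' _ _ _
  have hmem (n : ℕ) : x n ∈ S := by
    induction n with
    | zero => exact h₀
    | succ n ih => rw [hsucc]; exact hT _ ih
  have hstep (n : ℕ) : X ^ n ∣ x (n + 1) - x n := by
    induction n with
    | zero => simp
    | succ n ih =>
      have := hc _ (hmem (n + 1)) _ (hmem n) n ih
      rwa [← hsucc, ← hsucc] at this
  have hstable (m k : ℕ) : coeff m (x (m + 1 + k)) = coeff m (x (m + 1)) := by
    induction k with
    | zero => rfl
    | succ k ih =>
      have := X_pow_dvd_iff.mp (hstep (m + 1 + k)) m (by omega)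
      rw [map_sub, sub_eq_zero] at this
      rw [← ih, ← this]; rfl
  set f : R⟦X⟧ := PowerSeries.mk fun n => coeff n (x (n + 1)) with hf
  have hlim (n : ℕ) : X ^ n ∣ f - x n := by
    rw [X_pow_dvd_iff]
    intro m hm
    obtain ⟨k, rfl⟩ := Nat.exists_eq_add_of_lt hm
    rw [map_sub, hf, coeff_mk, ← hstable m k, sub_eq_zero]
    congr 2
    omega
  have hfS : f ∈ S := hS _ _ (hmem 1) (by simpa using hlim 1)
  refine ⟨f, hfS, ?_⟩
  have hall (n : ℕ) : X ^ (n + 1) ∣ T f - f := by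
    have h1 := hc f hfS (x n) (hmem n) n (hlim n)
    rw [← hsucc] at h1
    simpa using dvd_sub h1 (hlim (n + 1))
  ext1 n
  have := X_pow_dvd_iff.mp (hall n) n (by omega)
  rwa [map_sub, sub_eq_zero] at this

/-- The Riccati equation for the logarithmic derivative of a wave function has a formal
solution, with differential polynomials as coefficients. -/
theorem exists_riccati_solution (ε : ℝ) (hε : ε ^ 2 = 1) : ∃ v : DiffPoly⟦X⟧,
    X ∣ v - algebraMap ℝ _ ε ∧
    scaledDeriv (scaledDeriv v) + 3 * v * scaledDeriv v + v ^ 3 + 2 * potential * v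
      + scaledDeriv potential = algebraMap ℝ _ ε := by
  set e : DiffPoly⟦X⟧ := algebraMap ℝ _ ε with he
  have he2 : e ^ 2 = 1 := by rw [he, ← map_pow, hε, map_one]
  have hde : seriesDeriv e = 0 := Derivation.map_algebraMap _ _
  obtain ⟨c, hc⟩ : ∃ c : DiffPoly⟦X⟧, 3 * c = 1 :=
    ⟨algebraMap ℝ _ (1 / 3), by
      rw [← map_ofNat (algebraMap ℝ DiffPoly⟦X⟧) 3, ← map_mul]; norm_num⟩
  obtain ⟨f, hfS, hf⟩ := exists_fixedPoint_of_contracting {f : DiffPoly⟦X⟧ | X ∣ f - e}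
    (fun f => f - c * (scaledDeriv (scaledDeriv f) + 3 * f * scaledDeriv f + f ^ 3
      + 2 * potential * f + scaledDeriv potential - e)) e (by simp)
    (fun f g hf hg => by simpa using dvd_add hg hf)
    (by
      intro f hf
      rw [Set.mem_ofPred_eq, X_dvd_iff, map_sub, sub_eq_zero] at hf ⊢
      have he2' := congrArg constantCoeff he2
      rw [map_pow, map_one] at he2'
      simp only [scaledDeriv_apply, potential, map_sub, map_add, map_mul, map_pow, hf,
        constantCoeff_X]
      linear_combination -constantCoeff c * constantCoeff e * he2')
    (by
      rintro f ⟨a, ha⟩ g ⟨b, hb⟩ n ⟨d, hd⟩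
      obtain rfl : f = g + X ^ n * d := by linear_combination hd
      have hd' : X ^ n * d = X * (a - b) := by linear_combination ha - hb
      -- the linear terms cancel because `v³` has derivative `3` at `v = ±1`
      refine ⟨-c * (X * seriesDeriv (seriesDeriv d) + 3 * (g + X ^ n * d) * seriesDeriv d
        + 3 * d * seriesDeriv g + 3 * d * (2 * e * b + X * b ^ 2) + 3 * g * d * (a - b)
        + X ^ n * d * d * (a - b) + 2 * X * C (U 0) * d), ?_⟩
      simp only [map_add, scaledDeriv_X_pow_mul, scaledDeriv_apply g, potential]
      linear_combination (-X ^ n * d) * hc - 3 * c * X ^ n * d * he2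
        - 3 * c * X ^ n * d * (g + e + X * b) * hb
        - c * (3 * g + X ^ n * d) * X ^ n * d * hd')
  refine ⟨f, hfS, ?_⟩
  linear_combination -3 * hf - (scaledDeriv (scaledDeriv f) + 3 * f * scaledDeriv f + f ^ 3
      + 2 * potential * f + scaledDeriv potential - e) * hc
end Series

section Resolvent
/-! ### The local solution of the resolvent equations -/

open PowerSeries

/-- The generating functions `α` of the `hₙ` and `ρ` of the `qₙ`: solutions of the equations of
`waveProduct_identities` with differential polynomials as coefficients. The constant terms of
these coefficients are recorded because `D⁻¹` is normalised at the zero jet. -/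
theorem exists_resolvent : ∃ α ρ : DiffPoly⟦X⟧,
    (scaledDeriv (scaledDeriv (scaledDeriv α)) + 2 * potential * scaledDeriv α
      + scaledDeriv potential * α = 3 * scaledDeriv ρ) ∧
    (scaledDeriv (scaledDeriv (scaledDeriv (scaledDeriv (scaledDeriv ρ))))
      + 10 * potential * scaledDeriv (scaledDeriv (scaledDeriv ρ))
      + 15 * scaledDeriv potential * scaledDeriv (scaledDeriv ρ)
      + (9 * scaledDeriv (scaledDeriv potential) + 16 * potential ^ 2) * scaledDeriv ρ
      + (2 * scaledDeriv (scaledDeriv (scaledDeriv potential))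
        + 16 * potential * scaledDeriv potential) * ρ = -9 * scaledDeriv α) ∧
    constantCoeff α = MvPolynomial.C (2 / 3) ∧ constantCoeff ρ = MvPolynomial.C (1 / 3) ∧
    (∀ i, MvPolynomial.constantCoeff (coeff (i + 1) α) = 0) ∧
    (∀ i, MvPolynomial.constantCoeff (coeff (i + 1) ρ) = 0) := by
  obtain ⟨v, hvX, hv⟩ := exists_riccati_solution 1 (by norm_num)
  obtain ⟨w, hwX, hw⟩ := exists_riccati_solution (-1) (by norm_num)
  rw [map_one] at hvX hv
  rw [map_neg, map_one] at hwX hw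
  have hv0 : constantCoeff v = 1 := by
    rw [X_dvd_iff, map_sub, sub_eq_zero] at hvX; simpa using hvX
  have hw0 : constantCoeff w = -1 := by
    rw [X_dvd_iff, map_sub, sub_eq_zero] at hwX; simpa using hwX
  have h3 : (3 : DiffPoly) * MvPolynomial.C (1 / 3) = 1 := by
    rw [← map_ofNat MvPolynomial.C 3, ← map_mul]; norm_num
  set b := scaledDeriv v + scaledDeriv w + v ^ 2 - v * w + w ^ 2 + 2 * potential with hb
  have hb0 : constantCoeff b = 3 := by
    simp only [hb, scaledDeriv_apply, potential, map_add, map_sub, map_mul, map_pow,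
      constantCoeff_X, hv0, hw0]
    ring
  obtain ⟨ρ, hρ⟩ : ∃ ρ, b * ρ = 1 := by
    refine (isUnit_iff_constantCoeff.mpr ?_).exists_right_inv
    rw [hb0]
    exact IsUnit.of_mul_eq_one _ h3
  obtain ⟨h₁, h₂⟩ := resolvent_identities scaledDeriv hv hw hρ
  have hρ0 : constantCoeff ρ = MvPolynomial.C (1 / 3) := by
    have := congrArg constantCoeff hρ
    rw [map_mul, hb0, map_one] at this
    linear_combination MvPolynomial.C (1 / 3) * this - constantCoeff ρ * h3
  -- At the zero jet, the Riccati equations reduce to `v³ = 1` and `w³ = -1`.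
  set π : DiffPoly⟦X⟧ →+* ℝ⟦X⟧ := PowerSeries.map MvPolynomial.constantCoeff with hπ
  have hπδ (f : DiffPoly⟦X⟧) : π (scaledDeriv f) = 0 := by
    have : π (seriesDeriv f) = 0 := by ext1 n; simp [hπ]
    rw [scaledDeriv_apply, map_mul, this, mul_zero]
  have hπW : π potential = 0 := by simp [hπ, potential]
  have hπv : π v = 1 := by
    have h := congrArg π hv
    simp only [map_add, map_mul, map_pow, hπδ, hπW, map_one] at h
    have h0 : constantCoeff (π v) = 1 := by
      rw [← coeff_zero_eq_constantCoeff_apply, hπ, coeff_map, coeff_zero_eq_constantCoeff_apply,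
        hv0]
      simp
    have h' : (π v - 1) * (π v ^ 2 + π v + 1) = 0 := by linear_combination h
    rcases mul_eq_zero.mp h' with h' | h'
    · linear_combination h'
    · have := congrArg constantCoeff h'
      simp only [map_add, map_pow, h0, map_one, map_zero] at this
      norm_num at this
  have hπw : π w = -1 := by
    have h := congrArg π hw
    simp only [map_add, map_mul, map_pow, map_neg, hπδ, hπW, map_one] at h
    have h0 : constantCoeff (π w) = -1 := by
      rw [← coeff_zero_eq_constantCoeff_apply, hπ, coeff_map, coeff_zero_eq_constantCoeff_apply,
        hw0]
      simp
    have h' : (π w + 1) * (π w ^ 2 - π w + 1) = 0 := by linear_combination h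
    rcases mul_eq_zero.mp h' with h' | h'
    · linear_combination h'
    · have := congrArg constantCoeff h'
      simp only [map_add, map_sub, map_pow, h0, map_one, map_zero] at this
      norm_num at this
  have hπρ : π ρ = C (1 / 3) := by
    have h := congrArg π hρ
    simp only [hb, map_add, map_sub, map_mul, map_pow, hπδ, hπW, hπv, hπw, map_one] at h
    have hC : (3 : ℝ⟦X⟧) * C (1 / 3) = 1 := by
      rw [← map_ofNat C 3, ← map_mul]; norm_num
    linear_combination C (1 / 3) * h - π ρ * hC
  have hπα : π ((v - w) * ρ) = C (2 / 3) := by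
    rw [map_mul, map_sub, hπv, hπw, hπρ, show (1 : ℝ⟦X⟧) - -1 = C 2 by
      rw [map_ofNat]; norm_num, ← map_mul]
    norm_num
  refine ⟨(v - w) * ρ, ρ, h₁, h₂, ?_, hρ0, fun i => ?_, fun i => ?_⟩
  · rw [map_mul, map_sub, hv0, hw0, hρ0, show (1 : DiffPoly) - -1 = MvPolynomial.C 2 by
      rw [map_ofNat]; norm_num, ← map_mul]
    norm_num
  · have := congrArg (coeff (i + 1)) hπα
    rwa [hπ, coeff_map, coeff_C, if_neg (Nat.succ_ne_zero i)] at this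
  · have := congrArg (coeff (i + 1)) hπρ
    rwa [hπ, coeff_map, coeff_C, if_neg (Nat.succ_ne_zero i)] at this

/-- The fifth-order operator `M(r) = D⁵r + 10uD³r + 15u₁D²r + (9u₂ + 16u²)Dr +
(2u₃ + 16uu₁)r`, the local form of the composition `D𝒥D`. -/
noncomputable def opM (r : DiffPoly) : DiffPoly :=
  totalDerivPow 5 r + 10 * U 0 * totalDerivPow 3 r + 15 * U 1 * totalDerivPow 2 r
    + (9 * U 2 + 16 * U 0 ^ 2) * totalDeriv r + (2 * U 3 + 16 * U 0 * U 1) * r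

/-- The recursion satisfied by the coefficients of `α` and `ρ`. It is local: no inverse of `D`
occurs, so it exhibits every `𝒟 aᵢ` and every `M(rᵢ)` as a total derivative. -/
theorem exists_resolvent_coeffs : ∃ a r : ℕ → DiffPoly,
    (∀ i, opD (a i) = 3 * totalDeriv (r (i + 2))) ∧
    (∀ i, opM (r i) = -9 * totalDeriv (a (i + 4))) ∧
    a 0 = MvPolynomial.C (2 / 3) ∧ r 0 = MvPolynomial.C (1 / 3) ∧
    (∀ i, MvPolynomial.constantCoeff (a (i + 1)) = 0) ∧
    (∀ i, MvPolynomial.constantCoeff (r (i + 1)) = 0) := by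
  obtain ⟨α, ρ, h₁, h₂, hα, hρ, hα0, hρ0⟩ := exists_resolvent
  have hX : (X : DiffPoly⟦X⟧) ≠ 0 := X_ne_zero
  simp only [scaledDeriv_apply, potential, Derivation.leibniz, seriesDeriv_X, seriesDeriv_X_pow,
    seriesDeriv_C, totalDeriv_U, smul_eq_mul, mul_zero, add_zero] at h₁ h₂
  have g₁ : X ^ 2 * (seriesDeriv (seriesDeriv (seriesDeriv α))
      + C (2 * U 0) * seriesDeriv α + C (U 1) * α) = C 3 * seriesDeriv ρ := by
    apply mul_left_cancel₀ hX
    simp only [map_mul, map_ofNat]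
    linear_combination h₁
  have g₂ : X ^ 4 * (seriesDeriv (seriesDeriv (seriesDeriv (seriesDeriv (seriesDeriv ρ))))
      + C (10 * U 0) * seriesDeriv (seriesDeriv (seriesDeriv ρ))
      + C (15 * U 1) * seriesDeriv (seriesDeriv ρ)
      + C (9 * U 2 + 16 * U 0 ^ 2) * seriesDeriv ρ
      + C (2 * U 3 + 16 * U 0 * U 1) * ρ) = C (-9) * seriesDeriv α := by
    apply mul_left_cancel₀ hX
    simp only [map_mul, map_add, map_pow, map_neg, map_ofNat]
    linear_combination h₂
  refine ⟨fun i => coeff i α, fun i => coeff i ρ, fun i => ?_, fun i => ?_, ?_, ?_, hα0, hρ0⟩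
  · have := congrArg (coeff (i + 2)) g₁
    rw [coeff_X_pow_mul] at this
    simp only [map_add, coeff_C_mul, coeff_seriesDeriv] at this
    simp only [opD, totalDerivPow_succ, totalDerivPow_zero]
    linear_combination this
  · have := congrArg (coeff (i + 4)) g₂
    rw [coeff_X_pow_mul] at this
    simp only [map_add, add_mul, coeff_C_mul, coeff_seriesDeriv] at this
    simp only [opM, totalDerivPow_succ, totalDerivPow_zero]
    linear_combination this
  · simpa using hα
  · simpa using hρ

end Resolvent

/-! ### Locality of the hierarchy -/

/-- If `M(q) = D g`, then `u₍₀₎D³q + 4u₍₀₎²Dq` is a total derivative and `𝒥(D q) = g`: all terms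
of `M(q)` other than twice this one are manifestly total derivatives. -/
theorem exists_potential_of_opM_eq {q g : DiffPoly} (hq : MvPolynomial.constantCoeff q = 0)
    (hg : MvPolynomial.constantCoeff g = 0) (h : opM q = totalDeriv g) :
    ∃ r : DiffPoly, totalDeriv r = U 0 * totalDerivPow 3 q + 4 * U 0 ^ 2 * totalDeriv q ∧
      MvPolynomial.constantCoeff r = 0 ∧
      g = totalDerivPow 4 q + 8 * U 0 * totalDerivPow 2 q + 7 * U 1 * totalDeriv q
        + 2 * (U 2 + 4 * U 0 ^ 2) * q + 2 * r ∧
      opJ (totalDeriv q) = g := by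
  have hhalf : (2 : DiffPoly) * MvPolynomial.C (1 / 2) = 1 := by
    rw [← map_ofNat MvPolynomial.C 2, ← map_mul]; norm_num
  set r : DiffPoly := MvPolynomial.C (1 / 2) * (g - (totalDerivPow 4 q
    + 8 * U 0 * totalDerivPow 2 q + 7 * U 1 * totalDeriv q + 2 * (U 2 + 4 * U 0 ^ 2) * q)) with hr
  have hr0 : MvPolynomial.constantCoeff r = 0 := by
    simp [hr, hq, hg, totalDerivPow_succ]
  have hDr : totalDeriv r = U 0 * totalDerivPow 3 q + 4 * U 0 ^ 2 * totalDeriv q := by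
    rw [hr, Derivation.leibniz, totalDeriv_C, map_sub, ← h]
    simp only [opM, totalDerivPow_succ, totalDerivPow_zero, map_add, Derivation.leibniz, pow_two,
      totalDeriv_U, smul_eq_mul, derivation_ofNat totalDeriv 8, derivation_ofNat totalDeriv 7,
      derivation_ofNat totalDeriv 2, derivation_ofNat totalDeriv 4]
    linear_combination (U 0 * totalDeriv (totalDeriv (totalDeriv q)) + 4 * U 0 ^ 2 * totalDeriv q) * hhalf
  have hgr : g = totalDerivPow 4 q + 8 * U 0 * totalDerivPow 2 q + 7 * U 1 * totalDeriv q
        + 2 * (U 2 + 4 * U 0 ^ 2) * q + 2 * r := by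
    rw [hr]
    linear_combination -(g - (totalDerivPow 4 q
      + 8 * U 0 * totalDerivPow 2 q + 7 * U 1 * totalDeriv q
      + 2 * (U 2 + 4 * U 0 ^ 2) * q)) * hhalf
  refine ⟨r, hDr, hr0, hgr, ?_⟩
  rw [opJ, invD_eq rfl hq, ← totalDerivPow_succ' 2, invD_eq hDr hr0, hgr]
  rfl

lemma opD_C_mul (c : ℝ) (p : DiffPoly) :
    opD (MvPolynomial.C c * p) = MvPolynomial.C c * opD p := by
  simp only [← MvPolynomial.smul_eq_C_mul, opD, totalDerivPow_succ, totalDerivPow_zero, totalDeriv_smul,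
    mul_smul_comm, smul_add]

lemma opM_C_mul (c : ℝ) (p : DiffPoly) :
    opM (MvPolynomial.C c * p) = MvPolynomial.C c * opM p := by
  simp only [← MvPolynomial.smul_eq_C_mul, opM, totalDerivPow_succ, totalDerivPow_zero, totalDeriv_smul,
    mul_smul_comm, smul_add]

lemma totalDeriv_C_mul (c : ℝ) (p : DiffPoly) :
    totalDeriv (MvPolynomial.C c * p) = MvPolynomial.C c * totalDeriv p := by
  rw [← MvPolynomial.smul_eq_C_mul, ← MvPolynomial.smul_eq_C_mul, totalDeriv_smul]

/-- The hierarchy is local, and the recursion `hₙ₊₂ = 𝒥𝒟hₙ` can be evaluated with explicit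
primitives `q` and `r`. The reason is that, up to constant factors, `hₙ` and `qₙ` are coefficients
of the generating functions `α` and `ρ`. -/
theorem exists_flux (n : ℕ) : ∃ q r : DiffPoly,
    MvPolynomial.constantCoeff q = 0 ∧ MvPolynomial.constantCoeff r = 0 ∧
    totalDeriv q = opD (hPoly n) ∧
    totalDeriv r = U 0 * totalDerivPow 3 q + 4 * U 0 ^ 2 * totalDeriv q ∧
    hPoly (n + 2) = totalDerivPow 4 q + 8 * U 0 * totalDerivPow 2 q + 7 * U 1 * totalDeriv q
        + 2 * (U 2 + 4 * U 0 ^ 2) * q + 2 * r := by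
  obtain ⟨a, r, ha, hr, ha0, hr0, hac, hrc⟩ := exists_resolvent_coeffs
  have step (n i : ℕ) (c : ℝ) (h : hPoly n = MvPolynomial.C c * a i) :
      ∃ q s : DiffPoly, MvPolynomial.constantCoeff q = 0 ∧ MvPolynomial.constantCoeff s = 0 ∧
      totalDeriv q = opD (hPoly n) ∧
      totalDeriv s = U 0 * totalDerivPow 3 q + 4 * U 0 ^ 2 * totalDeriv q ∧
      hPoly (n + 2) = totalDerivPow 4 q + 8 * U 0 * totalDerivPow 2 q + 7 * U 1 * totalDeriv q
        + 2 * (U 2 + 4 * U 0 ^ 2) * q + 2 * s ∧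
      hPoly (n + 2) = MvPolynomial.C (-27 * c) * a (i + 6) := by
    have hq : MvPolynomial.constantCoeff (MvPolynomial.C (3 * c) * r (i + 2)) = 0 := by
      rw [map_mul, hrc, mul_zero]
    have hg : MvPolynomial.constantCoeff (MvPolynomial.C (-27 * c) * a (i + 6)) = 0 := by
      rw [map_mul, hac, mul_zero]
    have hDq : totalDeriv (MvPolynomial.C (3 * c) * r (i + 2)) = opD (hPoly n) := by
      rw [h, opD_C_mul, ha, totalDeriv_C_mul, map_mul, map_ofNat]; ring
    obtain ⟨s, hs, hs0, hgs, hJ⟩ := exists_potential_of_opM_eq hq hg (by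
      rw [opM_C_mul, hr, totalDeriv_C_mul, map_mul, map_mul, map_neg, map_ofNat, map_ofNat]; ring)
    have hh : hPoly (n + 2) = MvPolynomial.C (-27 * c) * a (i + 6) := by
      rw [hPoly, ← hDq, hJ]
    exact ⟨_, s, hq, hs0, hDq, hs, hh.trans hgs, hh⟩
  -- `r₀ = 1/3` gives `-9 D a₄ = M(1/3) = (2/3) D h₁`, which fixes the factor.
  have h1 : hPoly 1 = MvPolynomial.C (-27 / 2) * a 4 := by
    refine eq_of_totalDeriv_eq ?_ (by simp [hPoly, hac])
    have h := hr 0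
    rw [hr0] at h
    simp only [opM, totalDerivPow_succ, totalDerivPow_zero, totalDeriv_C, map_zero] at h
    rw [totalDeriv_C_mul]
    simp only [hPoly, map_add, Derivation.leibniz, pow_two, totalDeriv_U, smul_eq_mul, derivation_ofNat totalDeriv 4]
    have hc : (3 : DiffPoly) * MvPolynomial.C (1 / 3) = 1 := by
      rw [← map_ofNat MvPolynomial.C 3, ← map_mul]; norm_num
    have hc' : MvPolynomial.C (-27 / 2) = -27 * (MvPolynomial.C (1 / 2) : DiffPoly) := by
      rw [← map_ofNat MvPolynomial.C 27, ← map_neg, ← map_mul]; norm_num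
    have hc2 : (2 : DiffPoly) * MvPolynomial.C (1 / 2) = 1 := by
      rw [← map_ofNat MvPolynomial.C 2, ← map_mul]; norm_num
    rw [hc']
    linear_combination 3 * MvPolynomial.C (1 / 2) * h - (U 3 + 8 * U 0 * U 1) * hc
      - (3 * U 3 + 24 * U 0 * U 1) * MvPolynomial.C (1 / 3) * hc2
  have main : ∀ n, ∃ i c, hPoly n = MvPolynomial.C c * a i := by
    intro n
    induction n using hPoly.induct with
    | case1 =>
      refine ⟨0, 3 / 2, ?_⟩
      rw [ha0, ← map_mul, hPoly]; norm_num
    | case2 => exact ⟨4, _, h1⟩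
    | case3 n ih =>
      obtain ⟨i, c, h⟩ := ih
      obtain ⟨_, _, _, _, _, _, _, h'⟩ := step n i c h
      exact ⟨_, _, h'⟩
  obtain ⟨i, c, h⟩ := main n
  obtain ⟨q, s, h1, h2, h3, h4, h5, -⟩ := step n i c h
  exact ⟨q, s, h1, h2, h3, h4, h5⟩

/-! ### The seventh-order operator -/

/-- The operator `𝒮`, with the nonlocal term `D⁻¹(u₍₀₎D³p + 4u₍₀₎²Dp)` as an independent
argument `r`, in order to have linearity without reference to the domain of `D⁻¹`. -/
noncomputable def opSAux (p r : DiffPoly) : DiffPoly :=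
  (1 / 9 : ℝ) • (U 1 * r)
    + (1 / 9 : ℝ) • ((20 * U 0 ^ 2 * U 1 + 25 * U 1 * U 2 + 10 * U 0 * U 3 + U 5) * p)
    + (MvPolynomial.C (3 / 2 : ℝ) + (16 / 9 : ℝ) • U 0 ^ 3 + (71 / 18 : ℝ) • U 1 ^ 2
        + (41 / 9 : ℝ) • (U 0 * U 2) + (13 / 18 : ℝ) • U 4) * totalDeriv p
    + ((59 / 9 : ℝ) • (U 0 * U 1) + (35 / 18 : ℝ) • U 3) * totalDerivPow 2 p
    + (2 * U 0 ^ 2 + (49 / 18 : ℝ) • U 2) * totalDerivPow 3 p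
    + 2 * U 1 * totalDerivPow 4 p
    + (2 / 3 : ℝ) • (U 0 * totalDerivPow 5 p)
    + (1 / 18 : ℝ) • totalDerivPow 7 p

lemma opS_eq_opSAux {p r : DiffPoly}
    (h : totalDeriv r = U 0 * totalDerivPow 3 p + 4 * U 0 ^ 2 * totalDeriv p)
    (h0 : MvPolynomial.constantCoeff r = 0) : opS p = opSAux p r := by
  rw [opS, opSAux, invD_eq h h0]

lemma eighteen_mul_opSAux (p r : DiffPoly) : 18 * opSAux p r =
    2 * U 1 * r + 2 * (20 * U 0 ^ 2 * U 1 + 25 * U 1 * U 2 + 10 * U 0 * U 3 + U 5) * p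
    + (27 + 32 * U 0 ^ 3 + 71 * U 1 ^ 2 + 82 * (U 0 * U 2) + 13 * U 4) * totalDeriv p
    + (118 * (U 0 * U 1) + 35 * U 3) * totalDerivPow 2 p
    + (36 * U 0 ^ 2 + 49 * U 2) * totalDerivPow 3 p
    + 36 * U 1 * totalDerivPow 4 p + 12 * U 0 * totalDerivPow 5 p + totalDerivPow 7 p := by
  have hc : (18 : DiffPoly) * MvPolynomial.C (1 / 18) = 1 := by
    rw [← map_ofNat MvPolynomial.C 18, ← map_mul]; norm_num
  have e (m : ℝ) : (MvPolynomial.C (m * (1 / 18)) : DiffPoly)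
      = MvPolynomial.C m * MvPolynomial.C (1 / 18) := map_mul _ _ _
  rw [opSAux, show (1 / 9 : ℝ) = 2 * (1 / 18) by norm_num,
    show (3 / 2 : ℝ) = 27 * (1 / 18) by norm_num,
    show (16 / 9 : ℝ) = 32 * (1 / 18) by norm_num,
    show (71 / 18 : ℝ) = 71 * (1 / 18) by norm_num,
    show (41 / 9 : ℝ) = 82 * (1 / 18) by norm_num,
    show (13 / 18 : ℝ) = 13 * (1 / 18) by norm_num,
    show (59 / 9 : ℝ) = 118 * (1 / 18) by norm_num,
    show (35 / 18 : ℝ) = 35 * (1 / 18) by norm_num,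
    show (49 / 18 : ℝ) = 49 * (1 / 18) by norm_num,
    show (2 / 3 : ℝ) = 12 * (1 / 18) by norm_num]
  simp only [MvPolynomial.smul_eq_C_mul, e, map_ofNat]
  linear_combination (2 * U 1 * r
    + 2 * (20 * U 0 ^ 2 * U 1 + 25 * U 1 * U 2 + 10 * U 0 * U 3 + U 5) * p
    + (27 + 32 * U 0 ^ 3 + 71 * U 1 ^ 2 + 82 * (U 0 * U 2) + 13 * U 4) * totalDeriv p
    + (118 * (U 0 * U 1) + 35 * U 3) * totalDerivPow 2 p
    + 49 * U 2 * totalDerivPow 3 p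
    + 12 * U 0 * totalDerivPow 5 p + totalDerivPow 7 p) * hc

/-- The identity `𝒟𝒥D = 18𝒮 - 27D`, on densities `q` with zero constant term, for which
`D⁻¹Dq = q`. -/
theorem opD_eq_opSAux {q r : DiffPoly}
    (hr : totalDeriv r = U 0 * totalDerivPow 3 q + 4 * U 0 ^ 2 * totalDeriv q) :
    opD (totalDerivPow 4 q + 8 * U 0 * totalDerivPow 2 q + 7 * U 1 * totalDeriv q
        + 2 * (U 2 + 4 * U 0 ^ 2) * q + 2 * r) = 18 * opSAux q r - 27 * totalDeriv q := by
  rw [eighteen_mul_opSAux]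
  simp only [totalDerivPow_succ, totalDerivPow_zero] at hr ⊢
  simp only [opD, totalDerivPow_succ, totalDerivPow_zero, map_add, Derivation.leibniz, pow_two,
    totalDeriv_U, smul_eq_mul, derivation_ofNat totalDeriv 8, derivation_ofNat totalDeriv 7,
    derivation_ofNat totalDeriv 2, derivation_ofNat totalDeriv 4, hr, mul_zero, add_zero]
  ring

lemma opSAux_add (p p' r r' : DiffPoly) :
    opSAux (p + p') (r + r') = opSAux p r + opSAux p' r' := by
  simp only [opSAux, totalDerivPow_add, map_add, mul_add, smul_add]
  abel

lemma opSAux_smul (c : ℝ) (p r : DiffPoly) : opSAux (c • p) (c • r) = c • opSAux p r := by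
  simp only [opSAux, totalDerivPow_succ, totalDerivPow_zero, totalDeriv_smul, mul_smul_comm, smul_add,
    smul_comm c]

/-! ### The summed densities -/

/-- With the truncated subtraction in `ell`, the value of `vPoly` at the index `0` is the one that
makes `vPoly_add_two` and `exists_factorisation` start at `n = 0`. -/
lemma vPoly_zero : vPoly 0 = 0 := by simp [vPoly, ell, wPoly]

lemma vPoly_one : vPoly 1 = MvPolynomial.C 9 := by
  have : ell 1 = 0 := by simp [ell]
  simp only [vPoly, this, Finset.sum_range_succ, Finset.sum_range_zero]
  simp only [pow_zero, zero_add, one_mul, mul_zero, Nat.sub_zero, wPoly]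
  rw [← map_ofNat MvPolynomial.C 18, ← map_mul]; norm_num

lemma vPoly_add_two (n : ℕ) : vPoly (n + 2) = 18 * qPoly n - 27 * vPoly n := by
  rcases Nat.eq_zero_or_pos n with rfl | hn
  · have h : ell 2 = 0 := by simp [ell]
    rw [vPoly_zero]; simp [vPoly, h, wPoly]
  · have h : ell (n + 2) = ell n + 1 := by
      by_cases hn2 : Even n
      · obtain ⟨k, rfl⟩ := hn2
        simp [ell, Nat.even_add]; omega
      · simp [ell, Nat.even_add, hn2]
    rw [vPoly, h, Finset.sum_range_succ', vPoly]
    have hs : ∑ k ∈ Finset.range (ell n + 1), (-27) ^ (k + 1) * wPoly (n + 2 - 2 * (k + 1))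
        = -27 * ∑ k ∈ Finset.range (ell n + 1), (-27) ^ k * wPoly (n - 2 * k) := by
      rw [Finset.mul_sum]
      refine Finset.sum_congr rfl fun k _ => ?_
      rw [show n + 2 - 2 * (k + 1) = n - 2 * k by omega]
      ring
    rw [hs]
    simp only [pow_zero, one_mul, mul_zero, Nat.sub_zero, wPoly]
    ring

lemma lam_add_two (n : ℕ) : lam (n + 2) = -27 * lam n := by
  simp only [lam, Nat.even_add_one, not_not]
  split_ifs
  · rw [Nat.add_div_right n two_pos, pow_succ]; ring
  · ring

/-- The identity `𝒟hₙ = 𝒮(vₙ) + λₙu₍₁₎`, with a primitive for the nonlocal term. The induction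
step combines `𝒟hₙ₊₂ = 18𝒮(qₙ) - 27𝒟hₙ` with `vₙ₊₂ = 18qₙ - 27vₙ`. -/
theorem exists_factorisation (n : ℕ) : ∃ r : DiffPoly,
    totalDeriv r = U 0 * totalDerivPow 3 (vPoly n) + 4 * U 0 ^ 2 * totalDeriv (vPoly n) ∧
    MvPolynomial.constantCoeff r = 0 ∧
    opD (hPoly n) = opSAux (vPoly n) r + lam n • U 1 := by
  induction n using hPoly.induct with
  | case1 =>
    refine ⟨0, ?_, map_zero _, ?_⟩
    · simp [vPoly_zero]
    · simp [vPoly_zero, opSAux, lam, opD, hPoly, totalDerivPow_succ]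
  | case2 =>
    refine ⟨0, ?_, map_zero _, ?_⟩
    · simp [vPoly_one, totalDerivPow_succ]
    · have h9 : (1 / 9 : ℝ) • (MvPolynomial.C 9 : DiffPoly) = 1 := by
        rw [MvPolynomial.smul_eq_C_mul, ← map_mul]; norm_num
      have hl : lam 1 = 0 := by simp [lam]
      simp only [vPoly_one, opSAux, hl, opD, hPoly, totalDerivPow_succ, totalDerivPow_zero, totalDeriv_C,
        map_zero, mul_zero, smul_zero, zero_add, add_zero, zero_smul, ← mul_smul_comm, h9, mul_one]
      simp only [map_add, Derivation.leibniz, pow_two, totalDeriv_U, smul_eq_mul, derivation_ofNat totalDeriv 4, mul_zero,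
        add_zero]
      ring
  | case3 n ih =>
    obtain ⟨s, hs, hs0, ih⟩ := ih
    obtain ⟨q, r, hq0, hr0, hq, hr, hh⟩ := exists_flux n
    have hqn : qPoly n = q := invD_eq hq hq0
    have hv : vPoly (n + 2) = (18 : ℝ) • q + (-27 : ℝ) • vPoly n := by
      rw [vPoly_add_two, hqn, MvPolynomial.smul_eq_C_mul, MvPolynomial.smul_eq_C_mul, map_neg,
        map_ofNat, map_ofNat]
      ring
    refine ⟨(18 : ℝ) • r + (-27 : ℝ) • s, ?_, ?_, ?_⟩
    · rw [hv]
      simp only [totalDerivPow_succ, totalDerivPow_zero, map_add, totalDeriv_smul] at hr hs ⊢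
      rw [hr, hs]
      simp only [mul_add, mul_smul_comm, smul_add]
      abel
    · simp [hr0, hs0, MvPolynomial.smul_eq_C_mul]
    · rw [hv, opSAux_add, opSAux_smul, opSAux_smul, hh, opD_eq_opSAux hr, hq, ih, lam_add_two]
      simp only [MvPolynomial.smul_eq_C_mul, map_mul, map_neg, map_ofNat]
      ring

end KaupKupershmidt

theorem proposition1 :
    -- the hierarchy is well defined: all fluxes are local and lie in `P[u]`
    (∀ k : ℕ,
      KaupKupershmidt.totalDeriv (KaupKupershmidt.qPoly k)
          = KaupKupershmidt.opD (KaupKupershmidt.hPoly k) ∧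
      KaupKupershmidt.qPoly k ∈ KaupKupershmidt.PSpace) ∧
    ∀ n : ℕ, 1 ≤ n →
      KaupKupershmidt.vPoly n ∈ KaupKupershmidt.PSpace ∧
      -- the identity of differential polynomials
      KaupKupershmidt.opD (KaupKupershmidt.hPoly n)
          = KaupKupershmidt.opS (KaupKupershmidt.vPoly n)
            + KaupKupershmidt.lam n • KaupKupershmidt.U 1 ∧
      -- the two forms of the evolution equation
      ∀ (Ω : Set (ℝ × ℝ)) (u : ℝ × ℝ → ℝ), IsOpen Ω → ContDiffOn ℝ ∞ u Ω →
        (KaupKupershmidt.SolvesKK n Ω u ↔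
          ∀ z ∈ Ω, KaupKupershmidt.partialT u z
            + KaupKupershmidt.alongJet
                (KaupKupershmidt.opS (KaupKupershmidt.vPoly n)) u z
            + KaupKupershmidt.lam n * KaupKupershmidt.partialS 1 u z = 0) := by
  open KaupKupershmidt in
  refine ⟨fun k => ?_, fun n _ => ?_⟩
  · obtain ⟨q, r, hq0, -, hq, hr, -⟩ := exists_flux k
    have hqk : qPoly k = q := invD_eq hq hq0
    refine ⟨hqk ▸ hq, ?_⟩
    change euler _ = 0
    rw [hqk, ← hr, euler_totalDeriv]
  · obtain ⟨r, hr, hr0, h⟩ := exists_factorisation n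
    rw [← opS_eq_opSAux hr hr0] at h
    refine ⟨?_, h, fun Ω u _ _ => ?_⟩
    · change euler _ = 0
      rw [← hr, euler_totalDeriv]
    · refine forall₂_congr fun z _ => ?_
      rw [h]
      simp [alongJet, MvPolynomial.smul_eval, U, add_assoc]
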